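/- There is a universal constant $A>0$ such that the following holds. Let $\Lambda$ be a locally compact Polish space and $\lambda$ a positive Radon measure on $\Lambda$. Let $K:\Lambda\times\Lambda\to\mathbb{C}$ be a measurable function such that, for all $x,z\in\Lambda$, $K(z,x)=\overline{K(x,z)}$ and $\int K(x,y)K(y,z)\,d\lambda(y)=K(x,z)$ (with convergent integral), so that the associated integral operator $(T\varphi)(x)=\int K(x,y)\varphi(y)\,d\lambda(y)$ on $L^2(\lambda)$ is a self-adjoint projection. Assume that $T$ has finite rank, and denote this rank by $r(K)$. Let $X$ be a determinantal point process on $\Lambda$ with kernel $K$ and reference measure $\lambda$, i.e. a random locally finite set of points of $\Lambda$ whose $k$-point correlation functions with respect to $\lambda$ are $\det\big(K(x_i,x_j)\big)_{i,j=1}^k$ for all $k$. Let $f:\Lambda\to\mathbb{R}$ be a bounded measurable function, put $\|f\|_\infty=\sup_{x\in\Lambda}|f(x)|$, and let $X_f=\sum_{x\in X}f(x)$ be the associated linear statistic. Then $X_f$ is square integrable, $$\operatorname{Var} X_f\le 2\,r(K)\,\|f\|_\infty^2,$$ and, if $f$ is not identically zero, for every $\varepsilon>0$ $$P\big(|X_f-\mathbb{E}X_f|\ge\varepsilon\big)\le\begin{cases}2\exp\left(-\dfrac{\varepsilon^2}{8A\,r(K)\,\|f\|_\infty^2}\right),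 & \text{if } \varepsilon<\dfrac{4A\,r(K)\,\|f\|_\infty}{3},\\[2ex] 2\exp\left(-\dfrac{\varepsilon}{6\,\|f\|_\infty}\right), & \text{if } \varepsilon\ge\dfrac{4A\,r(K)\,\|f\|_\infty}{3}.\end{cases}$$ The constant $A$ does not depend on $\Lambda,\lambda,K,X,f$ or $\varepsilon$. -/

import Mathlib

open MeasureTheory ProbabilityTheory
open scoped ENNReal ComplexConjugate

namespace DPP

/-- `K` is a measurable kernel on `Λ` with `K(y,x) = conj K(x,y)` and
`∫ K(x,y) K(y,z) dλ(y) = K(x,z)` for all `x, z` (the integral being convergent): the kernel of a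
self-adjoint projection. The identities hold at every point, so the values on the diagonal are
determined. -/
structure IsProjectionKernel {Λ : Type*} [MeasurableSpace Λ] (lam : Measure Λ)
    (K : Λ → Λ → ℂ) : Prop where
  measurable : Measurable (Function.uncurry K)
  conj_symm : ∀ x y, K y x = conj (K x y)
  integrable : ∀ x z, Integrable (fun y => K x y * K y z) lam
  reproducing : ∀ x z, ∫ y, K x y * K y z ∂lam = K x z

section Operator

variable {Λ : Type*} [MeasurableSpace Λ] {lam : Measure Λ} {K : Λ → Λ → ℂ}

theorem IsProjectionKernel.memLp (hK : IsProjectionKernel lam K) (x : Λ) :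
    MemLp (fun y => K y x) 2 lam := by
  have hm : Measurable (fun y => K y x) := hK.measurable.comp (measurable_id.prodMk measurable_const)
  rw [memLp_two_iff_integrable_sq_norm hm.aestronglyMeasurable]
  refine (hK.integrable x x).norm.congr (Filter.Eventually.of_forall fun y => ?_)
  simp only [norm_mul]
  rw [hK.conj_symm y x, RCLike.norm_conj, sq]

/-- The section `y ↦ K(y,x)` as an element of `L²(λ)`. -/
noncomputable def IsProjectionKernel.sec (hK : IsProjectionKernel lam K) (x : Λ) : Lp ℂ 2 lam :=
  (hK.memLp x).toLp _

theorem IsProjectionKernel.inner_sec (hK : IsProjectionKernel lam K) (x : Λ) (f : Lp ℂ 2 lam) :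
    inner ℂ (hK.sec x) f = ∫ y, K x y * f y ∂lam := by
  rw [L2.inner_def]
  refine integral_congr_ae ?_
  filter_upwards [(hK.memLp x).coeFn_toLp] with y hy
  rw [IsProjectionKernel.sec, hy, RCLike.inner_apply, ← hK.conj_symm y x, mul_comm]

/-- On the closed span of the sections the kernel reproduces: `∫ K(x,y) g(y) dλ(y) = g(x)`. -/
theorem IsProjectionKernel.reproducing_closure (hK : IsProjectionKernel lam K) (g : Lp ℂ 2 lam)
    (hg : g ∈ (Submodule.span ℂ (Set.range hK.sec)).topologicalClosure) :
    g =ᵐ[lam] fun x => ∫ y, K x y * g y ∂lam := by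
  have hspan : ∀ h ∈ Submodule.span ℂ (Set.range hK.sec),
      h =ᵐ[lam] fun x => inner ℂ (hK.sec x) h := by
    intro h hh
    induction hh using Submodule.span_induction with
    | mem h hh =>
      obtain ⟨z, rfl⟩ := hh
      filter_upwards [(hK.memLp z).coeFn_toLp] with x hx
      rw [hK.inner_sec, ← integral_congr_ae
        (show (fun y => K x y * K y z) =ᵐ[lam] fun y => K x y * hK.sec z y from ?_),
        hK.reproducing]
      · exact hx
      · filter_upwards [(hK.memLp z).coeFn_toLp] with y hy
        rw [IsProjectionKernel.sec, hy]
    | zero =>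
      filter_upwards [Lp.coeFn_zero ℂ 2 lam] with x hx
      rw [inner_zero_right]
      exact hx
    | add u v _ _ hu hv =>
      filter_upwards [Lp.coeFn_add u v, hu, hv] with x hx hu hv
      rw [hx, Pi.add_apply, hu, hv, inner_add_right]
    | smul c u _ hu =>
      filter_upwards [Lp.coeFn_smul c u, hu] with x hx hu
      rw [hx, Pi.smul_apply, hu, inner_smul_right, smul_eq_mul]
  have hg' : g ∈ closure (Submodule.span ℂ (Set.range hK.sec) : Set (Lp ℂ 2 lam)) := hg
  obtain ⟨u, hu, hlim⟩ := mem_closure_iff_seq_limit.1 hg'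
  obtain ⟨ns, hns, hae⟩ := (tendstoInMeasure_of_tendsto_Lp hlim).exists_seq_tendsto_ae
  have hall : ∀ᵐ x ∂lam, ∀ n, u n x = inner ℂ (hK.sec x) (u n) :=
    ae_all_iff.2 fun n => hspan _ (hu n)
  filter_upwards [hae, hall] with x hx hall
  rw [← hK.inner_sec]
  refine tendsto_nhds_unique hx ?_
  simp only [hall]
  exact ((continuous_const.inner continuous_id).tendsto g).comp (hlim.comp hns.tendsto_atTop)

theorem IsProjectionKernel.memLp_integral (hK : IsProjectionKernel lam K) (f : Lp ℂ 2 lam) :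
    MemLp (fun x => ∫ y, K x y * f y ∂lam) 2 lam := by
  set H := (Submodule.span ℂ (Set.range hK.sec)).topologicalClosure with hH
  have : CompleteSpace H := (Submodule.isClosed_topologicalClosure _).completeSpace_coe
  have h1 := hK.reproducing_closure (H.starProjection f) (H.starProjection_apply_mem f)
  have h2 : ∀ x, ∫ y, K x y * (H.starProjection f) y ∂lam = ∫ y, K x y * f y ∂lam := by
    intro x
    have hx : hK.sec x ∈ H :=
      Submodule.le_topologicalClosure _ (Submodule.subset_span ⟨x, rfl⟩)
    rw [← hK.inner_sec, ← hK.inner_sec, ← Submodule.inner_starProjection_left_eq_right,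
      Submodule.starProjection_eq_self_iff.2 hx]
  simp only [h2] at h1
  exact (memLp_congr_ae h1).1 (Lp.memLp _)

/-- The integral operator `(T f)(x) = ∫ K(x,y) f(y) dλ(y)` on `L²(λ)`. -/
noncomputable def integralOperator (hK : IsProjectionKernel lam K) :
    Lp ℂ 2 lam →ₗ[ℂ] Lp ℂ 2 lam where
  toFun f := (hK.memLp_integral f).toLp (fun x => ∫ y, K x y * f y ∂lam)
  map_add' f g := by
    rw [← MemLp.toLp_add, MemLp.toLp_eq_toLp_iff]
    refine Filter.Eventually.of_forall fun x => ?_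
    simp only [Pi.add_apply, ← hK.inner_sec, inner_add_right]
  map_smul' c f := by
    rw [RingHom.id_apply, ← MemLp.toLp_const_smul, MemLp.toLp_eq_toLp_iff]
    refine Filter.Eventually.of_forall fun x => ?_
    simp only [Pi.smul_apply, ← hK.inner_sec, inner_smul_right, smul_eq_mul]

/-- The integral operator of `K` has finite rank. -/
def HasFiniteRank (hK : IsProjectionKernel lam K) : Prop :=
  FiniteDimensional ℂ (LinearMap.range (integralOperator hK))

/-- The rank `r(K)` of the integral operator of `K`. -/
noncomputable def kernelRank (hK : IsProjectionKernel lam K) : ℕ :=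
  Module.finrank ℂ (LinearMap.range (integralOperator hK))

end Operator

/-- A (simple) point process: a random locally finite set of points `X ω ⊆ Λ` whose numbers of
points in measurable sets are random variables. -/
structure IsPointProcess {Ω Λ : Type*} [MeasurableSpace Ω] [TopologicalSpace Λ]
    [MeasurableSpace Λ] (X : Ω → Set Λ) : Prop where
  finite_inter : ∀ ω, ∀ C : Set Λ, IsCompact C → (X ω ∩ C).Finite
  measurable_card : ∀ B : Set Λ, MeasurableSet B →
    Measurable fun ω => ((X ω ∩ B).encard : ℝ≥0∞)

/-- `k`-tuples of pairwise distinct points of the configuration `S`. -/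
def distinctTuples {Λ : Type*} (S : Set Λ) (k : ℕ) : Set (Fin k → Λ) :=
  {x | Function.Injective x ∧ ∀ i, x i ∈ S}

/-- `ρ k` is the `k`-point correlation function of `X` with respect to `λ`, for every `k`: the
expected sum of `g` over the `k`-tuples of distinct points of `X` is `∫ g ρ_k dλ^k`. -/
def HasCorrelationFunctions {Ω Λ : Type*} [MeasurableSpace Ω] [MeasurableSpace Λ]
    (P : Measure Ω) (X : Ω → Set Λ) (lam : Measure Λ)
    (ρ : (k : ℕ) → (Fin k → Λ) → ℝ≥0∞) : Prop :=
  ∀ (k : ℕ) (g : (Fin k → Λ) → ℝ≥0∞), Measurable g →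
    ∫⁻ ω, ∑' x : distinctTuples (X ω) k, g x ∂P
      = ∫⁻ x, g x * ρ k x ∂(Measure.pi fun _ : Fin k => lam)

/-- `X` is a determinantal point process with kernel `K` and reference measure `λ`: its `k`-point
correlation functions are `det (K(x_i,x_j))_{i,j}`. (For the kernels considered here the matrix is
positive semidefinite, so that this determinant is a nonnegative real number.) -/
structure IsDeterminantal {Ω Λ : Type*} [MeasurableSpace Ω] [TopologicalSpace Λ]
    [MeasurableSpace Λ] (P : Measure Ω) (X : Ω → Set Λ) (lam : Measure Λ)
    (K : Λ → Λ → ℂ) : Prop where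
  isPointProcess : IsPointProcess X
  correlation : HasCorrelationFunctions P X lam fun _ x =>
    ENNReal.ofReal (Matrix.det (Matrix.of fun i j => K (x i) (x j))).re

/-- The linear statistic `X_f = ∑_{x ∈ X} f(x)`. -/
noncomputable def linearStatistic {Ω Λ : Type*} (X : Ω → Set Λ) (f : Λ → ℝ) (ω : Ω) : ℝ :=
  ∑' x : X ω, f x

/-- The supremum norm `‖f‖_∞` of a bounded function. -/
noncomputable def supNorm {Λ : Type*} (f : Λ → ℝ) : ℝ := ⨆ x, |f x|

end DPP

namespace DPP

/-! A determinantal process whose kernel is a projection of rank `r` almost surely has exactly `r`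
points. The trace `∫ K(x,x)` is `r`, and so is `∫∫ |K|²` by the reproducing identity, so the
second-moment formula makes the variance of the number of points vanish. Hence `|X_f| ≤ r‖f‖` almost
surely, and `f` may be replaced by the nonnegative function `f + ‖f‖`, which shifts `X_f` by a
constant.

The same formula gives `Var X_f = ½ ∫∫ (f(x) - f(y))² |K(x,y)|²`, which is at most `½ (2‖f‖)² r`.

For the tail, Hadamard's inequality bounds each correlation function by `∏ K(x_i,x_i)`, the one of
the Poisson process with the same intensity. Expanding `∏ (1 + g(x))` into elementary symmetric
functions of `g` then gives `E ∏ (1 + g(x)) ≤ exp ∫ g(x) K(x,x)` for `g ≥ 0`. With `g = exp (t(f +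
‖f‖)) - 1` and `2t‖f‖ ≤ 1`, Chernoff's bound yields the Gaussian estimate with `A = 2`. For this `A`
the second regime lies beyond `2r‖f‖`, where the probability is zero. -/

/-! ### Hadamard's inequality for Gram determinants. -/

open scoped ComplexOrder in
theorem det_gram_re_le_one {E n : Type*} [NormedAddCommGroup E] [InnerProductSpace ℂ E]
    [Fintype n] [DecidableEq n] (v : n → E) (hv : ∀ i, ‖v i‖ = 1) :
    (Matrix.gram ℂ v).det.re ≤ 1 := by
  have hp := Matrix.posSemidef_gram ℂ v
  have hH := hp.isHermitian
  have htr : ∑ i, hH.eigenvalues i = Fintype.card n := by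
    have h := hH.trace_eq_sum_eigenvalues
    have h2 : (Matrix.gram ℂ v).trace = (Fintype.card n : ℂ) := by
      simp [Matrix.trace, inner_self_eq_norm_sq_to_K, hv]
    rw [h2] at h
    have h3 := congrArg Complex.re h
    simpa using h3.symm
  rw [hH.det_eq_prod_eigenvalues]
  have : (∏ i, (hH.eigenvalues i : ℂ)).re = ∏ i, hH.eigenvalues i := by
    rw [← Complex.ofReal_prod, Complex.ofReal_re]
  refine this.trans_le ?_
  -- AM-GM in the form `s ≤ exp (s - 1)`: the eigenvalues are nonnegative and sum to the size of the
  -- matrix, so the exponents cancel.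
  calc ∏ i, hH.eigenvalues i ≤ ∏ i, Real.exp (hH.eigenvalues i - 1) :=
        Finset.prod_le_prod (fun i _ => hp.eigenvalues_nonneg i)
          fun i _ => by linarith [Real.add_one_le_exp (hH.eigenvalues i - 1)]
    _ = 1 := by rw [← Real.exp_sum, Finset.sum_sub_distrib, htr]; simp

/-- Hadamard's inequality for Gram matrices. -/
theorem det_gram_re_le_prod {E n : Type*} [NormedAddCommGroup E] [InnerProductSpace ℂ E]
    [Fintype n] [DecidableEq n] (v : n → E) :
    (Matrix.gram ℂ v).det.re ≤ ∏ i, ‖v i‖ ^ 2 := by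
  by_cases h0 : ∃ i, v i = 0
  · obtain ⟨i, hi⟩ := h0
    rw [Matrix.det_eq_zero_of_row_eq_zero i fun j => by simp [hi]]
    exact Finset.prod_nonneg fun i _ => by positivity
  push Not at h0
  set w : n → E := fun i => ((‖v i‖⁻¹ : ℝ) : ℂ) • v i with hw
  have hw1 : ∀ i, ‖w i‖ = 1 := fun i => by
    have := norm_ne_zero_iff.2 (h0 i)
    simp [hw, norm_smul, this]
  have hvw : ∀ i, v i = ((‖v i‖ : ℝ) : ℂ) • w i := fun i => by
    have : ((‖v i‖ : ℝ) : ℂ) ≠ 0 := by exact_mod_cast norm_ne_zero_iff.2 (h0 i)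
    simp [hw, smul_smul, this]
  have hfac : Matrix.gram ℂ v = Matrix.diagonal (fun i => ((‖v i‖ : ℝ) : ℂ)) * Matrix.gram ℂ w *
      Matrix.diagonal (fun i => ((‖v i‖ : ℝ) : ℂ)) := by
    ext i j
    rw [Matrix.mul_diagonal, Matrix.diagonal_mul, Matrix.gram_apply, Matrix.gram_apply]
    conv_lhs => rw [hvw i, hvw j]
    rw [inner_smul_left, inner_smul_right, Complex.conj_ofReal]
    ring
  have hdet : (Matrix.gram ℂ v).det = ((∏ i, ‖v i‖ ^ 2 : ℝ) : ℂ) * (Matrix.gram ℂ w).det := by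
    rw [hfac, Matrix.det_mul, Matrix.det_mul, Matrix.det_diagonal, Finset.prod_pow]
    push_cast
    ring
  rw [hdet, Complex.re_ofReal_mul]
  exact mul_le_of_le_one_right (Finset.prod_nonneg fun i _ => by positivity)
    (det_gram_re_le_one w hw1)

/-! ### Projection kernels: trace, rank and Hilbert-Schmidt norm. -/

section Kernel

variable {Λ : Type*} [MeasurableSpace Λ] {lam : Measure Λ} {K : Λ → Λ → ℂ}

theorem IsProjectionKernel.inner_sec_sec (hK : IsProjectionKernel lam K) (x y : Λ) :
    inner ℂ (hK.sec x) (hK.sec y) = K x y := by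
  rw [hK.inner_sec, ← hK.reproducing]
  refine integral_congr_ae ?_
  filter_upwards [(hK.memLp y).coeFn_toLp] with z hz
  rw [IsProjectionKernel.sec, hz]

theorem IsProjectionKernel.diag_re (hK : IsProjectionKernel lam K) (x : Λ) :
    (K x x).re = ‖hK.sec x‖ ^ 2 := by
  rw [← hK.inner_sec_sec x x, inner_self_eq_norm_sq_to_K]
  norm_cast

/-- The density of the intensity measure of a determinantal process. -/
noncomputable def intensity (K : Λ → Λ → ℂ) (x : Λ) : ℝ≥0∞ := ENNReal.ofReal (K x x).re

theorem IsProjectionKernel.measurable_intensity (hK : IsProjectionKernel lam K) :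
    Measurable (intensity K) :=
  (Complex.measurable_re.comp
    (hK.measurable.comp (measurable_id.prodMk measurable_id))).ennreal_ofReal

theorem IsProjectionKernel.det_le (hK : IsProjectionKernel lam K) {k : ℕ} (x : Fin k → Λ) :
    ENNReal.ofReal (Matrix.det (Matrix.of fun i j => K (x i) (x j))).re
      ≤ ∏ i, intensity K (x i) := by
  have h : (Matrix.of fun i j => K (x i) (x j)) = Matrix.gram ℂ fun i => hK.sec (x i) := by
    ext i j
    simp [hK.inner_sec_sec]
  unfold intensity
  rw [h, ← ENNReal.ofReal_prod_of_nonneg fun i _ => by rw [hK.diag_re]; positivity]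
  refine ENNReal.ofReal_le_ofReal ((det_gram_re_le_prod _).trans_eq ?_)
  exact Finset.prod_congr rfl fun i _ => (hK.diag_re _).symm

/-- This is the reproducing identity on the diagonal, since `K(x,y) K(y,x) = |K(x,y)|²`. -/
theorem IsProjectionKernel.lintegral_sq (hK : IsProjectionKernel lam K) (x : Λ) :
    ∫⁻ y, ENNReal.ofReal (‖K x y‖ ^ 2) ∂lam = intensity K x := by
  have hi := hK.integrable x x
  have e : ∀ y, K x y * K y x = ((‖K x y‖ ^ 2 : ℝ) : ℂ) := fun y => by
    rw [hK.conj_symm x y, Complex.mul_conj, Complex.normSq_eq_norm_sq]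
  simp only [e] at hi
  have hi' : Integrable (fun y => ‖K x y‖ ^ 2) lam := by
    simpa only [RCLike.re_eq_complex_re, Complex.ofReal_re] using hi.re
  rw [← ofReal_integral_eq_lintegral_ofReal hi' (Filter.Eventually.of_forall fun y => by positivity)]
  have h := hK.reproducing x x
  simp only [e] at h
  rw [integral_complex_ofReal] at h
  rw [intensity, ← h, Complex.ofReal_re]

theorem integralOperator_ae (hK : IsProjectionKernel lam K) (f : Lp ℂ 2 lam) :
    integralOperator hK f =ᵐ[lam] fun x => ∫ y, K x y * f y ∂lam :=
  (hK.memLp_integral f).coeFn_toLp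

theorem integralOperator_eq_self (hK : IsProjectionKernel lam K) (g : Lp ℂ 2 lam)
    (hg : g ∈ (Submodule.span ℂ (Set.range hK.sec)).topologicalClosure) :
    integralOperator hK g = g :=
  Lp.ext ((integralOperator_ae hK g).trans (hK.reproducing_closure g hg).symm)

/-- The operator fixes the closed span of the sections, and it sees a function only through its
inner products with the sections, hence only through its orthogonal projection onto that span. -/
theorem range_integralOperator (hK : IsProjectionKernel lam K) :
    LinearMap.range (integralOperator hK)
      = (Submodule.span ℂ (Set.range hK.sec)).topologicalClosure := by
  refine le_antisymm ?_ fun g hg => ⟨g, integralOperator_eq_self hK g hg⟩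
  rintro _ ⟨f, rfl⟩
  set H := (Submodule.span ℂ (Set.range hK.sec)).topologicalClosure with hH
  have : CompleteSpace H := (Submodule.isClosed_topologicalClosure _).completeSpace_coe
  have h1 := hK.reproducing_closure (H.starProjection f) (H.starProjection_apply_mem f)
  have h2 : ∀ x, ∫ y, K x y * (H.starProjection f) y ∂lam = ∫ y, K x y * f y ∂lam := by
    intro x
    have hx : hK.sec x ∈ H :=
      Submodule.le_topologicalClosure _ (Submodule.subset_span ⟨x, rfl⟩)
    rw [← hK.inner_sec, ← hK.inner_sec, ← Submodule.inner_starProjection_left_eq_right,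
      Submodule.starProjection_eq_self_iff.2 hx]
  simp only [h2] at h1
  have : integralOperator hK f = H.starProjection f :=
    Lp.ext ((integralOperator_ae hK f).trans h1.symm)
  rw [this]
  exact H.starProjection_apply_mem f

/-- The trace of the kernel is the rank of its operator. -/
theorem lintegral_intensity (hK : IsProjectionKernel lam K) (hr : HasFiniteRank hK) :
    ∫⁻ x, intensity K x ∂lam = kernelRank hK := by
  set V := LinearMap.range (integralOperator hK) with hV
  have : FiniteDimensional ℂ V := hr
  have hVr := range_integralOperator hK
  rw [← hV] at hVr
  let b := stdOrthonormalBasis ℂ V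
  have hsec : ∀ x, hK.sec x ∈ V := fun x => by
    rw [hVr]; exact Submodule.le_topologicalClosure _ (Submodule.subset_span ⟨x, rfl⟩)
  -- Parseval for the section at `x`. Each coefficient has the modulus of `b i` at `x` for almost
  -- every `x`, so each basis vector contributes `1` to the trace.
  have hk : ∀ x, intensity K x
      = ∑ i, ENNReal.ofReal (‖inner ℂ (hK.sec x) (b i : Lp ℂ 2 lam)‖ ^ 2) := fun x => by
    rw [intensity, hK.diag_re, ← ENNReal.ofReal_sum_of_nonneg fun i _ => by positivity]
    congr 1
    exact (b.sum_sq_norm_inner_left ⟨hK.sec x, hsec x⟩).symm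
  have hb : ∀ i, (fun x => ENNReal.ofReal (‖inner ℂ (hK.sec x) (b i : Lp ℂ 2 lam)‖ ^ 2))
      =ᵐ[lam] fun x => ENNReal.ofReal (‖(b i : Lp ℂ 2 lam) x‖ ^ 2) := fun i => by
    filter_upwards [hK.reproducing_closure (b i) (hVr ▸ (b i).2)] with x hx
    rw [hK.inner_sec, ← hx]
  have hbm : ∀ i, AEMeasurable (fun x => ENNReal.ofReal (‖(b i : Lp ℂ 2 lam) x‖ ^ 2)) lam :=
    fun i => ((Lp.aestronglyMeasurable _).norm.pow 2).aemeasurable.ennreal_ofReal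
  simp only [hk]
  rw [lintegral_finsetSum' _ fun i _ => (hbm i).congr (hb i).symm]
  have h1 : ∀ i, ∫⁻ x, ENNReal.ofReal (‖inner ℂ (hK.sec x) (b i : Lp ℂ 2 lam)‖ ^ 2) ∂lam = 1 := by
    intro i
    rw [lintegral_congr_ae (hb i), ← ofReal_integral_eq_lintegral_ofReal
      ((memLp_two_iff_integrable_sq_norm (Lp.aestronglyMeasurable _)).1 (Lp.memLp _))
      (Filter.Eventually.of_forall fun x => by positivity)]
    have h := inner_self_eq_norm_sq_to_K (𝕜 := ℂ) (b i : Lp ℂ 2 lam)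
    have hn : ‖(b i : Lp ℂ 2 lam)‖ = 1 := b.orthonormal.1 i
    rw [hn, L2.inner_def] at h
    have e : ∀ x, inner ℂ ((b i : Lp ℂ 2 lam) x) ((b i : Lp ℂ 2 lam) x)
        = ((‖(b i : Lp ℂ 2 lam) x‖ ^ 2 : ℝ) : ℂ) := fun x => by
      rw [inner_self_eq_norm_sq_to_K]; norm_cast
    simp only [e] at h
    rw [integral_complex_ofReal] at h
    have h' : ∫ x, ‖(b i : Lp ℂ 2 lam) x‖ ^ 2 ∂lam = 1 := by
      have := congrArg Complex.re h
      simpa using this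
    rw [h', ENNReal.ofReal_one]
  simp only [h1]
  simp only [Finset.sum_const, Finset.card_univ, Fintype.card_fin, nsmul_one]
  rfl

theorem lintegral_fin_prod [SigmaFinite lam] (g : Λ → ℝ≥0∞) (hg : Measurable g) (k : ℕ) :
    ∫⁻ x, ∏ i, g (x i) ∂(Measure.pi fun _ : Fin k => lam) = (∫⁻ x, g x ∂lam) ^ k := by
  induction k with
  | zero => simp
  | succ k ih =>
    have hp := (measurePreserving_piFinSuccAbove (fun _ : Fin (k + 1) => lam) 0)
    have hm : Measurable fun x : Fin k → Λ => ∏ i, g (x i) := by fun_prop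
    have h := hp.lintegral_comp (f := fun q : Λ × (Fin k → Λ) => g q.1 * ∏ i, g (q.2 i))
      (by fun_prop)
    rw [lintegral_prod_mul hg.aemeasurable hm.aemeasurable, ih] at h
    rw [pow_succ', ← h]
    refine lintegral_congr fun x => ?_
    rw [Fin.prod_univ_succ]
    rfl

end Kernel

/-! ### Sums over tuples of distinct points. -/

section Tuples

variable {Λ : Type*}

/-- The sum of a nonnegative function over a configuration. -/
noncomputable def configSum (S : Set Λ) (g : Λ → ℝ≥0∞) : ℝ≥0∞ := ∑' x : S, g x

theorem tsum_distinctTuples_one (S : Set Λ) (g : Λ → ℝ≥0∞) :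
    ∑' x : distinctTuples S 1, g ((x : Fin 1 → Λ) 0) = configSum S g := by
  let e : distinctTuples S 1 ≃ S :=
    { toFun := fun x => ⟨x.1 0, x.2.2 0⟩
      invFun := fun y => ⟨fun _ => y.1, fun i j _ => Subsingleton.elim i j, fun _ => y.2⟩
      left_inv := fun x => Subtype.ext (funext fun i => by rw [Subsingleton.elim i 0])
      right_inv := fun _ => rfl }
  exact e.tsum_eq (fun y : S => g y)

/-- The square `S × S` splits into its off-diagonal part and its diagonal. -/
theorem tsum_distinctTuples_two (S : Set Λ) (g : Λ → ℝ≥0∞) :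
    ∑' x : distinctTuples S 2, g ((x : Fin 2 → Λ) 0) * g ((x : Fin 2 → Λ) 1)
      + configSum S (fun x => g x ^ 2) = configSum S g ^ 2 := by
  classical
  let F : distinctTuples S 2 ⊕ S → S × S := Sum.elim
    (fun x => (⟨x.1 0, x.2.2 0⟩, ⟨x.1 1, x.2.2 1⟩)) fun y => (y, y)
  have hF : Function.Bijective F := by
    constructor
    · rintro (x | x) (y | y) h
      · have h0 : x.1 0 = y.1 0 := congrArg (fun p : S × S => (p.1 : Λ)) h
        have h1 : x.1 1 = y.1 1 := congrArg (fun p : S × S => (p.2 : Λ)) h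
        congr 1
        refine Subtype.ext (funext fun i => ?_)
        fin_cases i
        exacts [h0, h1]
      · have h0 : x.1 0 = y := congrArg (fun p : S × S => (p.1 : Λ)) h
        have h1 : x.1 1 = y := congrArg (fun p : S × S => (p.2 : Λ)) h
        exact absurd (x.2.1 (h0.trans h1.symm)) (by decide)
      · have h0 : (x : Λ) = y.1 0 := congrArg (fun p : S × S => (p.1 : Λ)) h
        have h1 : (x : Λ) = y.1 1 := congrArg (fun p : S × S => (p.2 : Λ)) h
        exact absurd (y.2.1 (h0.symm.trans h1)) (by decide)
      · exact congrArg Sum.inr (congrArg Prod.fst h)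
    · rintro ⟨x, y⟩
      by_cases h : x = y
      · exact ⟨Sum.inr x, Prod.ext rfl h⟩
      · refine ⟨Sum.inl ⟨![x, y], ?_, ?_⟩, rfl⟩
        · have h' : (x : Λ) ≠ y := fun e => h (Subtype.ext e)
          intro i j hij
          fin_cases i <;> fin_cases j <;> simp_all
        · intro i
          fin_cases i
          exacts [x.2, y.2]
  have h1 : configSum S g ^ 2 = ∑' p : S × S, g p.1 * g p.2 := by
    rw [ENNReal.tsum_prod (f := fun a b : S => g a * g b), sq, configSum]
    simp only [ENNReal.tsum_mul_left, ENNReal.tsum_mul_right]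
  rw [h1, ← (Equiv.ofBijective F hF).tsum_eq, Summable.tsum_sum ENNReal.summable ENNReal.summable]
  simp [configSum, F, sq]

/-- Each `k`-subset is enumerated by `k!` tuples of distinct points. -/
theorem factorial_mul_sum_powersetCard_le [DecidableEq Λ] (S : Finset Λ) (k : ℕ)
    (g : Λ → ℝ≥0∞) :
    (k.factorial : ℝ≥0∞) * ∑ T ∈ S.powersetCard k, ∏ x ∈ T, g x
      ≤ ∑' x : distinctTuples (S : Set Λ) k, ∏ i, g ((x : Fin k → Λ) i) := by
  have hc : ∀ T : S.powersetCard k, T.1 ⊆ S ∧ T.1.card = k := fun T =>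
    Finset.mem_powersetCard.1 T.2
  let e : ∀ T : S.powersetCard k, Fin k ≃ T.1 := fun T =>
    (T.1.equivFinOfCardEq (hc T).2).symm
  let F : (S.powersetCard k) × Equiv.Perm (Fin k) → distinctTuples (S : Set Λ) k := fun p =>
    ⟨fun i => e p.1 (p.2 i),
      fun i j h => p.2.injective ((e p.1).injective (Subtype.ext h)),
      fun i => (hc p.1).1 (e p.1 (p.2 i)).2⟩
  have him : ∀ p, Finset.univ.image (F p).1 = p.1.1 := fun p => by
    ext x
    simp only [Finset.mem_image, Finset.mem_univ, true_and]
    constructor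
    · rintro ⟨i, rfl⟩
      exact (e p.1 (p.2 i)).2
    · intro hx
      exact ⟨p.2.symm ((e p.1).symm ⟨x, hx⟩), by simp [F]⟩
  have hF : Function.Injective F := by
    rintro ⟨T, σ⟩ ⟨T', σ'⟩ h
    have hT : T = T' := Subtype.ext (by rw [← him (T, σ), ← him (T', σ'), h])
    subst hT
    congr 1
    ext1 i
    have := congrFun (congrArg Subtype.val h) i
    exact (e T).injective (Subtype.ext this)
  refine le_trans (le_of_eq ?_) (ENNReal.tsum_comp_le_tsum_of_injective hF _)
  have hprod : ∀ p, ∏ i, g ((F p).1 i) = ∏ x ∈ p.1.1, g x := fun p => by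
    rw [← him p, Finset.prod_image fun i _ j _ h => (F p).2.1 h]
  simp only [hprod]
  rw [tsum_fintype, Fintype.sum_prod_type, ← Finset.sum_coe_sort (S.powersetCard k)]
  simp [Finset.mul_sum, Fintype.card_perm]

end Tuples

/-! ### First and second moments; the number of points. -/

section LinearStatistics

variable {Ω Λ : Type*} [MeasurableSpace Ω] [TopologicalSpace Λ] [MeasurableSpace Λ]
  {P : Measure Ω} {X : Ω → Set Λ} {lam : Measure Λ} {K : Λ → Λ → ℂ}

/-- Only counts are measurable by assumption; these are the case of indicators, from which sums and
monotone limits give all `g`. -/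
theorem IsPointProcess.measurable_configSum (hX : IsPointProcess X) {g : Λ → ℝ≥0∞}
    (hg : Measurable g) : Measurable fun ω => configSum (X ω) g := by
  refine Measurable.ennreal_induction
    (motive := fun g => Measurable fun ω => configSum (X ω) g) ?_ ?_ ?_ hg
  · intro c s hs
    have : ∀ ω, configSum (X ω) (s.indicator fun _ => c) = c * ((X ω ∩ s).encard : ℝ≥0∞) := by
      intro ω
      rw [configSum, tsum_subtype (X ω) (s.indicator fun _ => c), Set.indicator_indicator,
        ← tsum_subtype (X ω ∩ s) fun _ => c, ENNReal.tsum_const, mul_comm]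
      rfl
    simp only [this]
    exact (hX.measurable_card s hs).const_mul c
  · intro f g _ _ _ hf hg
    have : ∀ ω, configSum (X ω) (f + g) = configSum (X ω) f + configSum (X ω) g := fun ω =>
      ENNReal.tsum_add
    simp only [this]
    exact hf.add hg
  · intro f hf hmono h
    have : ∀ ω, configSum (X ω) (fun x => ⨆ n, f n x) = ⨆ n, configSum (X ω) (f n) := by
      intro ω
      simp only [configSum, ENNReal.tsum_eq_iSup_sum]
      rw [iSup_comm]
      refine iSup_congr fun s => ?_
      exact ENNReal.finsetSum_iSup_of_monotone fun x => fun n m hnm => hmono hnm x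
    simp only [this]
    exact Measurable.iSup h

theorem IsDeterminantal.lintegral_configSum (hX : IsDeterminantal P X lam K) [SigmaFinite lam]
    {g : Λ → ℝ≥0∞} (hg : Measurable g) (hK : Measurable (intensity K)) :
    ∫⁻ ω, configSum (X ω) g ∂P = ∫⁻ x, g x * intensity K x ∂lam := by
  have h := hX.correlation 1 (fun x => g (x 0)) (by fun_prop)
  simp only [tsum_distinctTuples_one] at h
  have h2 := lintegral_fin_prod (lam := lam) (fun x => g x * intensity K x) (by fun_prop) 1
  rw [pow_one] at h2
  rw [h, ← h2]
  simp [intensity]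

/-- The diagonal pairs give the one-point term, the others the two-point function `K(x,x)K(y,y) -
|K(x,y)|²`. The negative term is kept on the left to avoid truncated subtraction. -/
theorem IsDeterminantal.lintegral_configSum_sq (hX : IsDeterminantal P X lam K) [SigmaFinite lam]
    {g : Λ → ℝ≥0∞} (hg : Measurable g) (hK : IsProjectionKernel lam K) :
    ∫⁻ ω, configSum (X ω) g ^ 2 ∂P
        + ∫⁻ x, ∫⁻ y, g x * g y * ENNReal.ofReal (‖K x y‖ ^ 2) ∂lam ∂lam
      = ∫⁻ x, g x ^ 2 * intensity K x ∂lam + (∫⁻ x, g x * intensity K x ∂lam) ^ 2 := by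
  have hKm := hK.measurable
  have him := hK.measurable_intensity
  have h := hX.correlation 2 (fun x => g (x 0) * g (x 1)) (by fun_prop)
  have hc1 := hX.lintegral_configSum (g := fun x => g x ^ 2) (by fun_prop) him
  have hsq : ∫⁻ ω, configSum (X ω) g ^ 2 ∂P
      = ∫⁻ ω, ∑' x : distinctTuples (X ω) 2, g ((x : Fin 2 → Λ) 0) * g ((x : Fin 2 → Λ) 1) ∂P
        + ∫⁻ x, g x ^ 2 * intensity K x ∂lam := by
    simp only [← tsum_distinctTuples_two]
    rw [lintegral_add_right _ (hX.isPointProcess.measurable_configSum (by fun_prop)), hc1]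
  have hdet : ∀ x : Fin 2 → Λ,
      ENNReal.ofReal (Matrix.det (Matrix.of fun i j => K (x i) (x j))).re
        + ENNReal.ofReal (‖K (x 0) (x 1)‖ ^ 2) = ∏ i, intensity K (x i) := by
    intro x
    -- Cauchy-Schwarz: the determinant is nonnegative, so `ENNReal.ofReal` does not truncate it.
    have hnn : ‖K (x 0) (x 1)‖ ^ 2 ≤ (K (x 0) (x 0)).re * (K (x 1) (x 1)).re := by
      rw [hK.diag_re, hK.diag_re, ← hK.inner_sec_sec, ← mul_pow]
      exact pow_le_pow_left₀ (norm_nonneg _) (norm_inner_le_norm _ _) 2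
    have him : ∀ y, (K y y).im = 0 := fun y => by
      have := congrArg Complex.im (hK.conj_symm y y)
      rw [Complex.conj_im] at this
      linarith
    have hd : (Matrix.det (Matrix.of fun i j => K (x i) (x j))).re
        = (K (x 0) (x 0)).re * (K (x 1) (x 1)).re - ‖K (x 0) (x 1)‖ ^ 2 := by
      rw [Matrix.det_fin_two]
      simp only [Matrix.of_apply]
      rw [hK.conj_symm (x 0) (x 1), Complex.mul_conj, Complex.normSq_eq_norm_sq, Complex.sub_re,
        Complex.mul_re, him, Complex.ofReal_re]
      ring
    rw [hd, ← ENNReal.ofReal_add (by linarith) (by positivity), sub_add_cancel,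
      ENNReal.ofReal_mul (by rw [hK.diag_re]; positivity), Fin.prod_univ_two]
    rfl
  have hm2 : Measurable fun q : Λ × Λ => g q.1 * g q.2 * ENNReal.ofReal (‖K q.1 q.2‖ ^ 2) := by
    have : Measurable fun q : Λ × Λ => K q.1 q.2 := hKm
    fun_prop
  have hdouble : ∫⁻ x, ∫⁻ y, g x * g y * ENNReal.ofReal (‖K x y‖ ^ 2) ∂lam ∂lam
      = ∫⁻ x, g (x 0) * g (x 1) * ENNReal.ofReal (‖K (x 0) (x 1)‖ ^ 2)
          ∂(Measure.pi fun _ : Fin 2 => lam) := by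
    rw [← lintegral_prod (μ := lam) (ν := lam) _ hm2.aemeasurable,
      ← (measurePreserving_finTwoArrow lam).lintegral_comp hm2]
    rfl
  have hm2' : Measurable fun x : Fin 2 → Λ =>
      g (x 0) * g (x 1) * ENNReal.ofReal (‖K (x 0) (x 1)‖ ^ 2) := by
    have hp : Measurable fun x : Fin 2 → Λ => (x 0, x 1) := by fun_prop
    exact hm2.comp hp
  have hprod := lintegral_fin_prod (lam := lam) (fun x => g x * intensity K x) (by fun_prop) 2
  rw [hsq, h, hdouble, ← hprod, add_right_comm, ← lintegral_add_right _ hm2', add_comm]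
  congr 1
  refine lintegral_congr fun x => ?_
  rw [← mul_add, hdet, Fin.prod_univ_two, Fin.prod_univ_two]
  ring

/-- Hadamard's inequality makes the integrand at most a product over the points; the right side is
the Poisson factorial moment. -/
theorem IsDeterminantal.lintegral_tuples_le (hX : IsDeterminantal P X lam K) [SigmaFinite lam]
    {g : Λ → ℝ≥0∞} (hg : Measurable g) (hK : IsProjectionKernel lam K) (k : ℕ) :
    ∫⁻ ω, ∑' x : distinctTuples (X ω) k, ∏ i, g ((x : Fin k → Λ) i) ∂P
      ≤ (∫⁻ x, g x * intensity K x ∂lam) ^ k := by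
  have him := hK.measurable_intensity
  rw [hX.correlation k (fun x => ∏ i, g (x i)) (by fun_prop),
    ← lintegral_fin_prod (lam := lam) (fun x => g x * intensity K x) (by fun_prop) k]
  refine lintegral_mono fun x => ?_
  simp only [Finset.prod_mul_distrib]
  gcongr
  exact hK.det_le x

theorem IsDeterminantal.encard_eq_kernelRank_ae (hX : IsDeterminantal P X lam K) [SigmaFinite lam]
    [IsProbabilityMeasure P] (hK : IsProjectionKernel lam K) (hr : HasFiniteRank hK) :
    ∀ᵐ ω ∂P, (X ω).encard = kernelRank hK := by
  set r := kernelRank hK with hrdef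
  have htr := lintegral_intensity hK hr
  have hN := hX.lintegral_configSum (g := fun _ => 1) measurable_const hK.measurable_intensity
  have hN2 := hX.lintegral_configSum_sq (g := fun _ => 1) measurable_const hK
  have hm := hX.isPointProcess.measurable_configSum (g := fun _ => (1 : ℝ≥0∞)) measurable_const
  simp only [one_mul, one_pow, hK.lintegral_sq, htr, ← hrdef] at hN hN2
  -- Both `∫∫ |K|²` and `∫ K(x,x)` equal `r` and cancel, leaving second moment `r²`, the square of
  -- the mean.
  rw [add_comm, ENNReal.add_right_inj (ENNReal.natCast_ne_top r)] at hN2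
  have hfin : ∀ᵐ ω ∂P, configSum (X ω) (fun _ => 1) < ∞ :=
    ae_lt_top hm (by rw [hN]; exact ENNReal.natCast_ne_top r)
  set Z : Ω → ℝ := fun ω => (configSum (X ω) fun _ => 1).toReal with hZ
  have hZm : Measurable Z := hm.ennreal_toReal
  have hZ1 : ∫ ω, Z ω ∂P = r := by
    rw [integral_toReal hm.aemeasurable hfin, hN]; simp
  have hZ2 : ∫ ω, Z ω ^ 2 ∂P = r ^ 2 := by
    have : ∀ ω, Z ω ^ 2 = (configSum (X ω) (fun _ => 1) ^ 2).toReal := fun ω => by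
      rw [ENNReal.toReal_pow]
    simp only [this]
    rw [integral_toReal (hm.pow_const 2).aemeasurable
      (hfin.mono fun ω h => ENNReal.pow_lt_top h), hN2]
    simp
  have hZL : MemLp Z 2 P := by
    rw [memLp_two_iff_integrable_sq hZm.aestronglyMeasurable]
    have : ∀ ω, Z ω ^ 2 = (configSum (X ω) (fun _ => 1) ^ 2).toReal := fun ω => by
      rw [ENNReal.toReal_pow]
    simp only [this]
    refine integrable_toReal_of_lintegral_ne_top (hm.pow_const 2).aemeasurable ?_
    rw [hN2]
    exact ENNReal.pow_ne_top (ENNReal.natCast_ne_top r)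
  have hvar : variance Z P = 0 := by
    rw [variance_eq_sub hZL]
    simp [Pi.pow_apply, hZ1, hZ2]
  have hae := ae_eq_integral_of_variance_eq_zero hZL hvar
  filter_upwards [hae, hfin] with ω h hf
  rw [hZ1] at h
  have h2 : configSum (X ω) (fun _ => 1) = r := by
    rw [← ENNReal.ofReal_toReal hf.ne, ← ENNReal.ofReal_natCast, ← h]
  rw [configSum, ENNReal.tsum_set_one] at h2
  exact_mod_cast h2

end LinearStatistics

/-! ### Finite configurations and elementary symmetric functions. -/

theorem configSum_coe_finset {Λ : Type*} (S : Finset Λ) (g : Λ → ℝ≥0∞) :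
    configSum (S : Set Λ) g = ∑ x ∈ S, g x :=
  S.tsum_subtype' g

theorem linearStatistic_eq_sum {Ω Λ : Type*} {X : Ω → Set Λ} {ω : Ω} {S : Finset Λ}
    (h : X ω = S) (f : Λ → ℝ) : linearStatistic X f ω = ∑ x ∈ S, f x := by
  rw [linearStatistic, h]
  exact S.tsum_subtype' f

theorem linearStatistic_neg {Ω Λ : Type*} (X : Ω → Set Λ) (f : Λ → ℝ) (ω : Ω) :
    linearStatistic X (fun x => -f x) ω = -linearStatistic X f ω := by
  simp [linearStatistic, tsum_neg]

theorem exists_finset_of_encard {Λ : Type*} {s : Set Λ} {r : ℕ} (h : s.encard = r) :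
    ∃ S : Finset Λ, s = S ∧ S.card = r := by
  have hf := Set.finite_of_encard_eq_coe h
  refine ⟨hf.toFinset, hf.coe_toFinset.symm, ?_⟩
  rw [hf.encard_eq_coe_toFinset_card] at h
  exact_mod_cast h

/-- The weights with which the `k`-th elementary symmetric function of `r` numbers `g` is
recovered from the values `∏ (i + 1 + g)`, `i ≤ r`. -/
noncomputable def esymmWeight (r k i : ℕ) : ℝ :=
  (Lagrange.basis (Finset.range (r + 1)) (fun i : ℕ => (i : ℝ) + 1) i).coeff (r - k)

/-- The left side is a coefficient of `∏ (X + g x)`, whose degree is `S.card`; Lagrange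
interpolation at `S.card + 1` nodes recovers it. Products over the configuration are exponentials of
linear statistics, so this is what makes symmetric functions measurable in `ω`. -/
theorem sum_powersetCard_eq_sum_esymmWeight {Λ : Type*} (S : Finset Λ) (g : Λ → ℝ) {k : ℕ}
    (hk : k ≤ S.card) :
    ∑ T ∈ S.powersetCard k, ∏ x ∈ T, g x
      = ∑ i ∈ Finset.range (S.card + 1), (∏ x ∈ S, ((i : ℝ) + 1 + g x)) * esymmWeight S.card k i := by
  have h1 := S.prod_X_add_C_coeff g (k := S.card - k) (Nat.sub_le _ _)
  rw [Nat.sub_sub_self hk] at h1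
  rw [← h1, Lagrange.eq_interpolate (s := Finset.range (S.card + 1)) (v := fun i : ℕ => (i : ℝ) + 1)
    (f := ∏ i ∈ S, (Polynomial.X + Polynomial.C (g i))), Lagrange.interpolate_apply,
    Polynomial.finsetSum_coeff]
  · refine Finset.sum_congr rfl fun i _ => ?_
    rw [Polynomial.coeff_C_mul, Polynomial.eval_prod, esymmWeight]
    simp
  · intro i _ j _ h
    simpa using h
  · rw [Polynomial.degree_prod]
    simp only [Polynomial.degree_X_add_C, Finset.sum_const, nsmul_eq_mul, mul_one, Finset.card_range]
    exact_mod_cast Nat.lt_succ_self _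

theorem lintegral_shift_mul_intensity_le {Λ : Type*} [MeasurableSpace Λ] {lam : Measure Λ}
    {K : Λ → Λ → ℂ} {f : Λ → ℝ} {M : ℝ} (hK : IsProjectionKernel lam K) (hr : HasFiniteRank hK) (hM : ∀ x, |f x| ≤ M) :
    ∫⁻ x, ENNReal.ofReal (f x + M) * intensity K x ∂lam
      ≤ ENNReal.ofReal (2 * M) * kernelRank hK := by
  rw [← lintegral_intensity hK hr, ← lintegral_const_mul _ hK.measurable_intensity]
  refine lintegral_mono fun x => ?_
  gcongr
  linarith [le_abs_self (f x), hM x]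

/-! ### Poisson domination of exponential moments. -/

section LinearStatistics

variable {Ω Λ : Type*} [MeasurableSpace Ω] [TopologicalSpace Λ] [MeasurableSpace Λ]
  {P : Measure Ω} [IsProbabilityMeasure P] {X : Ω → Set Λ} {lam : Measure Λ} [SigmaFinite lam]
  {K : Λ → Λ → ℂ}

theorem IsDeterminantal.ae_exists_finset (hX : IsDeterminantal P X lam K)
    (hK : IsProjectionKernel lam K) (hr : HasFiniteRank hK) :
    ∀ᵐ ω ∂P, ∃ S : Finset Λ, X ω = S ∧ S.card = kernelRank hK :=
  (hX.encard_eq_kernelRank_ae hK hr).mono fun _ h => exists_finset_of_encard h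

/-- The exponential moments of nonnegative linear statistics are dominated by those of the
Poisson process with the same intensity. -/
theorem IsDeterminantal.lintegral_exp_le (hX : IsDeterminantal P X lam K)
    (hK : IsProjectionKernel lam K) (hr : HasFiniteRank hK) {h : Λ → ℝ} (hm : Measurable h)
    (h0 : ∀ x, 0 ≤ h x) {a : ℝ} (ha0 : 0 ≤ a)
    (ha : ∫⁻ x, ENNReal.ofReal (Real.exp (h x) - 1) * intensity K x ∂lam ≤ ENNReal.ofReal a) :
    ∫⁻ ω, ENNReal.ofReal (Real.exp (linearStatistic X h ω)) ∂P
      ≤ ENNReal.ofReal (Real.exp a) := by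
  classical
  set r := kernelRank hK with hrdef
  set g : Λ → ℝ := fun x => Real.exp (h x) - 1 with hg
  have hgm : Measurable g := by fun_prop
  have hg0 : ∀ x, 0 ≤ g x := fun x => by
    have := Real.add_one_le_exp (h x)
    have := h0 x
    simp only [hg]; linarith
  -- A measurable version of the `k`-th elementary symmetric function of `g` over the configuration.
  -- The nodes `i + 1` keep the logarithms nonnegative, so that nothing is lost in `ℝ≥0∞`.
  set d : ℕ → Ω → ℝ := fun k ω => ∑ i ∈ Finset.range (r + 1),
    Real.exp (configSum (X ω) fun x => ENNReal.ofReal (Real.log ((i : ℝ) + 1 + g x))).toReal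
      * esymmWeight r k i with hd
  have hdm : ∀ k, Measurable (d k) := fun k => by
    refine Finset.measurable_sum _ fun i _ => Measurable.mul_const ?_ _
    exact (hX.isPointProcess.measurable_configSum (by fun_prop)).ennreal_toReal.exp
  have hdS : ∀ ω, ∀ S : Finset Λ, X ω = S → S.card = r → ∀ k ≤ r,
      d k ω = ∑ T ∈ S.powersetCard k, ∏ x ∈ T, g x := by
    intro ω S hS hc k hk
    rw [sum_powersetCard_eq_sum_esymmWeight S g (hc ▸ hk), hc]
    refine Finset.sum_congr rfl fun i _ => ?_
    have hpos : ∀ x, 1 ≤ (i : ℝ) + 1 + g x := fun x => by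
      have := hg0 x
      have : (0 : ℝ) ≤ i := Nat.cast_nonneg i
      linarith
    rw [hS, configSum_coe_finset,
      ← ENNReal.ofReal_sum_of_nonneg fun x _ => Real.log_nonneg (hpos x),
      ENNReal.toReal_ofReal (Finset.sum_nonneg fun x _ => Real.log_nonneg (hpos x)), Real.exp_sum]
    congr 1
    exact Finset.prod_congr rfl fun x _ => Real.exp_log (by linarith [hpos x])
  have hae := hX.ae_exists_finset hK hr
  have hdk : ∀ k ≤ r, ∫⁻ ω, ENNReal.ofReal (d k ω) ∂P ≤ ENNReal.ofReal (a ^ k / k.factorial) := by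
    intro k hk
    have hle : ∀ᵐ ω ∂P, (k.factorial : ℝ≥0∞) * ENNReal.ofReal (d k ω)
        ≤ ∑' x : distinctTuples (X ω) k, ∏ i, ENNReal.ofReal (g ((x : Fin k → Λ) i)) := by
      filter_upwards [hae] with ω ⟨S, hS, hc⟩
      rw [hdS ω S hS hc k hk, hS,
        ENNReal.ofReal_sum_of_nonneg fun T _ => Finset.prod_nonneg fun x _ => hg0 x]
      simp only [ENNReal.ofReal_prod_of_nonneg fun x _ => hg0 x]
      exact factorial_mul_sum_powersetCard_le S k fun x => ENNReal.ofReal (g x)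
    have h1 := (lintegral_mono_ae hle).trans
      (hX.lintegral_tuples_le (g := fun x => ENNReal.ofReal (g x)) (by fun_prop) hK k)
    rw [lintegral_const_mul _ (hdm k).ennreal_ofReal] at h1
    have hfac : (0 : ℝ) < k.factorial := by exact_mod_cast k.factorial_pos
    rw [ENNReal.ofReal_div_of_pos hfac, ENNReal.ofReal_natCast, ENNReal.ofReal_pow ha0,
      ENNReal.le_div_iff_mul_le (Or.inl (by exact_mod_cast k.factorial_ne_zero))
        (Or.inl (ENNReal.natCast_ne_top _)), mul_comm]
    exact h1.trans (pow_le_pow_left' ha k)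
  -- The exponential is `∏ (1 + g x)` over the `r` points, expanded over subsets grouped by size.
  have hexp : ∀ᵐ ω ∂P, ENNReal.ofReal (Real.exp (linearStatistic X h ω))
      = ∑ k ∈ Finset.range (r + 1), ENNReal.ofReal (d k ω) := by
    filter_upwards [hae] with ω ⟨S, hS, hc⟩
    have hk : ∀ k ∈ Finset.range (r + 1), d k ω = ∑ T ∈ S.powersetCard k, ∏ x ∈ T, g x :=
      fun k hk => hdS ω S hS hc k (Finset.mem_range_succ_iff.1 hk)
    rw [← ENNReal.ofReal_sum_of_nonneg fun k hk' => by
        rw [hk k hk']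
        exact Finset.sum_nonneg fun T _ => Finset.prod_nonneg fun x _ => hg0 x,
      Finset.sum_congr rfl hk, hrdef, ← hc, ← Finset.sum_powerset,
      ← Finset.prod_one_add, linearStatistic_eq_sum hS, Real.exp_sum]
    simp [hg]
  rw [lintegral_congr_ae hexp, lintegral_finsetSum _ fun k _ => (hdm k).ennreal_ofReal]
  calc ∑ k ∈ Finset.range (r + 1), ∫⁻ ω, ENNReal.ofReal (d k ω) ∂P
      ≤ ∑ k ∈ Finset.range (r + 1), ENNReal.ofReal (a ^ k / k.factorial) :=
        Finset.sum_le_sum fun k hk => hdk k (Finset.mem_range_succ_iff.1 hk)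
    _ = ENNReal.ofReal (∑ k ∈ Finset.range (r + 1), a ^ k / k.factorial) :=
        (ENNReal.ofReal_sum_of_nonneg fun k _ => by positivity).symm
    _ ≤ ENNReal.ofReal (Real.exp a) := ENNReal.ofReal_le_ofReal (Real.sum_le_exp_of_nonneg ha0 _)

/-! ### Bounded linear statistics: variance, exponential moments, tails. -/

section Bounded

variable {f : Λ → ℝ} {M : ℝ}

/-- Shifting `f` by `M` makes it nonnegative and costs a constant because the number of points is
deterministic. The right side also supplies a measurable representative. -/
theorem IsDeterminantal.linearStatistic_ae_eq (hX : IsDeterminantal P X lam K)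
    (hK : IsProjectionKernel lam K) (hr : HasFiniteRank hK) (hM : ∀ x, |f x| ≤ M) :
    linearStatistic X f =ᵐ[P] fun ω =>
      (configSum (X ω) fun x => ENNReal.ofReal (f x + M)).toReal - M * kernelRank hK := by
  filter_upwards [hX.ae_exists_finset hK hr] with ω ⟨S, hS, hc⟩
  have h0 : ∀ x, 0 ≤ f x + M := fun x => by linarith [neg_abs_le (f x), hM x]
  rw [linearStatistic_eq_sum hS, hS, configSum_coe_finset,
    ← ENNReal.ofReal_sum_of_nonneg fun x _ => h0 x,
    ENNReal.toReal_ofReal (Finset.sum_nonneg fun x _ => h0 x), Finset.sum_add_distrib]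
  simp [hc, mul_comm]

theorem IsDeterminantal.aemeasurable_linearStatistic (hX : IsDeterminantal P X lam K)
    (hK : IsProjectionKernel lam K) (hr : HasFiniteRank hK) (hf : Measurable f)
    (hM : ∀ x, |f x| ≤ M) : AEMeasurable (linearStatistic X f) P :=
  ⟨_, (hX.isPointProcess.measurable_configSum (by fun_prop)).ennreal_toReal.sub_const _,
    hX.linearStatistic_ae_eq hK hr hM⟩

theorem IsDeterminantal.abs_linearStatistic_le (hX : IsDeterminantal P X lam K)
    (hK : IsProjectionKernel lam K) (hr : HasFiniteRank hK) (hM : ∀ x, |f x| ≤ M) :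
    ∀ᵐ ω ∂P, |linearStatistic X f ω| ≤ kernelRank hK * M := by
  filter_upwards [hX.ae_exists_finset hK hr] with ω ⟨S, hS, hc⟩
  rw [linearStatistic_eq_sum hS]
  refine (Finset.abs_sum_le_sum_abs _ _).trans ((Finset.sum_le_sum fun x _ => hM x).trans_eq ?_)
  simp [hc]

theorem IsDeterminantal.memLp_linearStatistic (hX : IsDeterminantal P X lam K)
    (hK : IsProjectionKernel lam K) (hr : HasFiniteRank hK) (hf : Measurable f)
    (hM : ∀ x, |f x| ≤ M) : MemLp (linearStatistic X f) 2 P :=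
  .of_bound (hX.aemeasurable_linearStatistic hK hr hf hM).aestronglyMeasurable _
    (hX.abs_linearStatistic_le hK hr hM)

theorem IsDeterminantal.integral_linearStatistic (hX : IsDeterminantal P X lam K)
    (hK : IsProjectionKernel lam K) (hr : HasFiniteRank hK) (hf : Measurable f)
    (hM : ∀ x, |f x| ≤ M) :
    ∫⁻ x, ENNReal.ofReal (f x + M) * intensity K x ∂lam
      = ENNReal.ofReal (∫ ω, linearStatistic X f ω ∂P + M * kernelRank hK) := by
  have hle := lintegral_shift_mul_intensity_le (lam := lam) (M := M) hK hr hM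
  have hne : ∫⁻ x, ENNReal.ofReal (f x + M) * intensity K x ∂lam ≠ ∞ :=
    ne_top_of_le_ne_top (ENNReal.mul_ne_top ENNReal.ofReal_ne_top (ENNReal.natCast_ne_top _)) hle
  have hm := hX.isPointProcess.measurable_configSum
    (g := fun x => ENNReal.ofReal (f x + M)) (by fun_prop)
  have hE := hX.lintegral_configSum (g := fun x => ENNReal.ofReal (f x + M)) (by fun_prop)
    hK.measurable_intensity
  have hfin := ae_lt_top hm (hE ▸ hne)
  have hint : Integrable (fun ω => (configSum (X ω) fun x => ENNReal.ofReal (f x + M)).toReal) P :=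
    integrable_toReal_of_lintegral_ne_top hm.aemeasurable (hE ▸ hne)
  rw [integral_congr_ae (hX.linearStatistic_ae_eq hK hr hM), integral_sub hint (integrable_const _),
    integral_toReal hm.aemeasurable hfin, hE]
  simp [hne]

theorem IsDeterminantal.variance_linearStatistic_le (hX : IsDeterminantal P X lam K)
    (hK : IsProjectionKernel lam K) (hr : HasFiniteRank hK) (hf : Measurable f)
    (hM : ∀ x, |f x| ≤ M) (hM0 : 0 ≤ M) :
    variance (linearStatistic X f) P ≤ 2 * kernelRank hK * M ^ 2 := by
  set r := kernelRank hK with hrdef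
  set g : Λ → ℝ≥0∞ := fun x => ENNReal.ofReal (f x + M) with hg
  have hgm : Measurable g := by fun_prop
  have hKm : Measurable fun q : Λ × Λ => K q.1 q.2 := hK.measurable
  have him := hK.measurable_intensity
  have htr := lintegral_intensity hK hr
  have h0 : ∀ x, 0 ≤ f x + M := fun x => by linarith [neg_abs_le (f x), hM x]
  have h2M : ∀ x, f x + M ≤ 2 * M := fun x => by linarith [le_abs_self (f x), hM x]
  have hsq := hX.lintegral_configSum_sq hgm hK
  set b := ∫⁻ x, g x ^ 2 * intensity K x ∂lam with hb
  set c := ∫⁻ x, ∫⁻ y, g x * g y * ENNReal.ofReal (‖K x y‖ ^ 2) ∂lam ∂lam with hc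
  set m := ∫⁻ x, g x * intensity K x ∂lam with hmdef
  -- The variance is `b - c`. Writing `b` as a double integral in either variable turns `2(b - c)`
  -- into `∫∫ (g(x) - g(y))² |K|²`.
  have hb1 : b = ∫⁻ x, ∫⁻ y, g x ^ 2 * ENNReal.ofReal (‖K x y‖ ^ 2) ∂lam ∂lam := by
    refine lintegral_congr fun x => ?_
    rw [lintegral_const_mul _ (by fun_prop), hK.lintegral_sq]
  have hb2 : b = ∫⁻ x, ∫⁻ y, g y ^ 2 * ENNReal.ofReal (‖K x y‖ ^ 2) ∂lam ∂lam := by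
    rw [hb1, lintegral_lintegral_swap (by fun_prop)]
    refine lintegral_congr fun x => lintegral_congr fun y => ?_
    rw [hK.conj_symm x y, RCLike.norm_conj]
  have hrM : ∫⁻ x, ∫⁻ y, ENNReal.ofReal ((2 * M) ^ 2) * ENNReal.ofReal (‖K x y‖ ^ 2) ∂lam ∂lam
      = ENNReal.ofReal ((2 * M) ^ 2) * r := by
    rw [← htr, ← lintegral_const_mul _ him]
    refine lintegral_congr fun x => ?_
    rw [lintegral_const_mul _ (by fun_prop), hK.lintegral_sq]
  -- This is `(g(x) - g(y))² ≤ (2M)²`, with the cross terms moved across to stay in `ℝ≥0∞`.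
  have hpt : ∀ x y, g x ^ 2 + g y ^ 2 ≤ g x * g y + g x * g y + ENNReal.ofReal ((2 * M) ^ 2) := by
    intro x y
    have hx := h0 x
    have hy := h0 y
    simp only [hg]
    rw [← ENNReal.ofReal_pow hx, ← ENNReal.ofReal_pow hy, ← ENNReal.ofReal_mul hx,
      ← ENNReal.ofReal_add (by positivity) (by positivity),
      ← ENNReal.ofReal_add (by positivity) (by positivity),
      ← ENNReal.ofReal_add (by positivity) (by positivity)]
    refine ENNReal.ofReal_le_ofReal ?_
    have : (f x - f y) ^ 2 ≤ (2 * M) ^ 2 :=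
      sq_le_sq' (by linarith [h2M y, h0 x]) (by linarith [h2M x, h0 y])
    nlinarith
  have hbc : b + b ≤ c + c + ENNReal.ofReal ((2 * M) ^ 2) * r := by
    have e1 : b + b = ∫⁻ x, ∫⁻ y, (g x ^ 2 + g y ^ 2) * ENNReal.ofReal (‖K x y‖ ^ 2) ∂lam ∂lam := by
      nth_rw 1 [hb1]
      rw [hb2, ← lintegral_add_left (Measurable.lintegral_prod_right' (f := fun q : Λ × Λ =>
        g q.1 ^ 2 * ENNReal.ofReal (‖K q.1 q.2‖ ^ 2)) (by fun_prop))]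
      refine lintegral_congr fun x => ?_
      rw [← lintegral_add_left (by fun_prop)]
      simp only [add_mul]
    have hcm : Measurable fun x => ∫⁻ y, g x * g y * ENNReal.ofReal (‖K x y‖ ^ 2) ∂lam :=
      Measurable.lintegral_prod_right' (f := fun q : Λ × Λ =>
        g q.1 * g q.2 * ENNReal.ofReal (‖K q.1 q.2‖ ^ 2)) (by fun_prop)
    rw [e1, ← hrM, hc, ← lintegral_add_left hcm,
      ← lintegral_add_left (f := fun x => ∫⁻ y, g x * g y * ENNReal.ofReal (‖K x y‖ ^ 2) ∂lam
        + ∫⁻ y, g x * g y * ENNReal.ofReal (‖K x y‖ ^ 2) ∂lam) (hcm.add hcm)]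
    refine lintegral_mono fun x => ?_
    rw [← lintegral_add_left (by fun_prop), ← lintegral_add_left (by fun_prop)]
    refine lintegral_mono fun y => ?_
    exact (mul_le_mul_left (hpt x y) _).trans_eq (by rw [add_mul, add_mul])
  have hcfin : c ≠ ∞ := by
    refine ne_top_of_le_ne_top (b := ENNReal.ofReal ((2 * M) ^ 2) * r)
      (ENNReal.mul_ne_top ENNReal.ofReal_ne_top (ENNReal.natCast_ne_top _)) ?_
    rw [← hrM]
    refine lintegral_mono fun x => lintegral_mono fun y => ?_
    simp only [hg]
    rw [← ENNReal.ofReal_mul (h0 x)]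
    gcongr
    rw [sq]
    exact mul_le_mul (h2M x) (h2M y) (h0 y) (by positivity)
  have hmfin : m ≠ ∞ := ne_top_of_le_ne_top
    (ENNReal.mul_ne_top ENNReal.ofReal_ne_top (ENNReal.natCast_ne_top _))
    (lintegral_shift_mul_intensity_le (lam := lam) (M := M) hK hr hM)
  have hbfin : b ≠ ∞ := by
    refine ne_top_of_le_ne_top (b := c + c + ENNReal.ofReal ((2 * M) ^ 2) * r) ?_
      (le_self_add.trans hbc)
    exact ENNReal.add_ne_top.2 ⟨ENNReal.add_ne_top.2 ⟨hcfin, hcfin⟩,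
      ENNReal.mul_ne_top ENNReal.ofReal_ne_top (ENNReal.natCast_ne_top _)⟩
  have hIfin : ∫⁻ ω, configSum (X ω) g ^ 2 ∂P ≠ ∞ :=
    ne_top_of_le_ne_top (ENNReal.add_ne_top.2 ⟨hbfin, ENNReal.pow_ne_top hmfin⟩)
      (le_self_add.trans_eq hsq)
  have hbc' : b.toReal + b.toReal ≤ c.toReal + c.toReal + (2 * M) ^ 2 * r := by
    have h := ENNReal.toReal_mono (ENNReal.add_ne_top.2 ⟨ENNReal.add_ne_top.2 ⟨hcfin, hcfin⟩,
      ENNReal.mul_ne_top ENNReal.ofReal_ne_top (ENNReal.natCast_ne_top _)⟩) hbc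
    rw [ENNReal.toReal_add hbfin hbfin, ENNReal.toReal_add (ENNReal.add_ne_top.2 ⟨hcfin, hcfin⟩)
      (ENNReal.mul_ne_top ENNReal.ofReal_ne_top (ENNReal.natCast_ne_top _)),
      ENNReal.toReal_add hcfin hcfin, ENNReal.toReal_mul, ENNReal.toReal_ofReal (by positivity)] at h
    simpa using h
  have hsq' : (∫⁻ ω, configSum (X ω) g ^ 2 ∂P).toReal + c.toReal = b.toReal + m.toReal ^ 2 := by
    rw [← ENNReal.toReal_add hIfin hcfin, hsq, ENNReal.toReal_add hbfin (ENNReal.pow_ne_top hmfin),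
      ENNReal.toReal_pow]
  have hNm := hX.isPointProcess.measurable_configSum hgm
  have hN1 := hX.lintegral_configSum hgm him
  have hfin := ae_lt_top hNm (by rw [hN1]; exact hmfin)
  have hZL : MemLp (fun ω => (configSum (X ω) g).toReal) 2 P := by
    rw [memLp_two_iff_integrable_sq hNm.ennreal_toReal.aestronglyMeasurable]
    simp only [← ENNReal.toReal_pow]
    exact integrable_toReal_of_lintegral_ne_top (hNm.pow_const 2).aemeasurable hIfin
  rw [variance_congr (hX.linearStatistic_ae_eq hK hr hM),
    variance_sub_const hNm.ennreal_toReal.aestronglyMeasurable, variance_eq_sub hZL]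
  simp only [Pi.pow_apply, ← ENNReal.toReal_pow]
  rw [integral_toReal (hNm.pow_const 2).aemeasurable
    (hfin.mono fun ω h => ENNReal.pow_lt_top h), integral_toReal hNm.aemeasurable hfin, hN1]
  linarith

theorem IsDeterminantal.mgf_linearStatistic_le (hX : IsDeterminantal P X lam K)
    (hK : IsProjectionKernel lam K) (hr : HasFiniteRank hK) (hf : Measurable f)
    (hM : ∀ x, |f x| ≤ M) {t : ℝ} (ht : 0 ≤ t) (htM : t * (2 * M) ≤ 1) :
    mgf (linearStatistic X f) P t
      ≤ Real.exp (t * ∫ ω, linearStatistic X f ω ∂P + kernelRank hK * (t * (2 * M)) ^ 2) := by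
  set r := kernelRank hK with hrdef
  set E := ∫ ω, linearStatistic X f ω ∂P with hE
  have him := hK.measurable_intensity
  have htr := lintegral_intensity hK hr
  have hint := hX.integral_linearStatistic hK hr hf hM
  have h0 : ∀ x, 0 ≤ f x + M := fun x => by linarith [neg_abs_le (f x), hM x]
  have h2M : ∀ x, f x + M ≤ 2 * M := fun x => by linarith [le_abs_self (f x), hM x]
  have hEM : 0 ≤ E + M * r := by
    have hb : -(r * M) ≤ E := by
      have h1 := integral_mono_ae (integrable_const (-(r * M)))
        ((hX.memLp_linearStatistic hK hr hf hM).integrable one_le_two)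
        ((hX.abs_linearStatistic_le hK hr hM).mono fun ω h => neg_le_of_abs_le h)
      simpa using h1
    linarith
  set a := t * (E + M * r) + (t * (2 * M)) ^ 2 * r with ha
  have ha0 : 0 ≤ a := by positivity
  have hale : ∫⁻ x, ENNReal.ofReal (Real.exp (t * (f x + M)) - 1) * intensity K x ∂lam
      ≤ ENNReal.ofReal a := by
    rw [ha, ENNReal.ofReal_add (by positivity) (by positivity), ENNReal.ofReal_mul ht, ← hint,
      ENNReal.ofReal_mul (by positivity), ENNReal.ofReal_natCast, ← htr,
      ← lintegral_const_mul _ (by fun_prop), ← lintegral_const_mul _ (by fun_prop),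
      ← lintegral_add_left (by fun_prop)]
    refine lintegral_mono fun x => ?_
    rw [← mul_assoc, ← ENNReal.ofReal_mul ht, ← add_mul, ← ENNReal.ofReal_add
      (mul_nonneg ht (h0 x)) (by positivity)]
    gcongr
    have hu0 : 0 ≤ t * (f x + M) := mul_nonneg ht (h0 x)
    have hu1 : t * (f x + M) ≤ t * (2 * M) := mul_le_mul_of_nonneg_left (h2M x) ht
    -- With `u = t(f x + M)` in `[0, 1]`, `exp u - 1 ≤ u + u²`; the linear term integrates to `t(E +
    -- M r)`, and `u²` is bounded by the constant `(2tM)²`.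
    have h1 := Real.abs_exp_sub_one_sub_id_le (x := t * (f x + M))
      (by rw [abs_of_nonneg hu0]; linarith)
    have h2 := pow_le_pow_left₀ hu0 hu1 2
    linarith [le_abs_self (Real.exp (t * (f x + M)) - 1 - t * (f x + M))]
  have hmain := hX.lintegral_exp_le hK hr (h := fun x => t * (f x + M)) (by fun_prop)
    (fun x => mul_nonneg ht (h0 x)) ha0 hale
  have hlin : ∀ᵐ ω ∂P, ENNReal.ofReal (Real.exp (linearStatistic X (fun x => t * (f x + M)) ω))
      = ENNReal.ofReal (Real.exp (t * M * r)) * ENNReal.ofReal (Real.exp (t * linearStatistic X f ω)) := by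
    filter_upwards [hX.ae_exists_finset hK hr] with ω ⟨S, hS, hc⟩
    rw [linearStatistic_eq_sum hS, linearStatistic_eq_sum hS, ← ENNReal.ofReal_mul (by positivity),
      ← Real.exp_add, ← Finset.mul_sum, Finset.sum_add_distrib]
    simp only [Finset.sum_const, hc, nsmul_eq_mul, ← hrdef]
    ring_nf
  have hYm := hX.aemeasurable_linearStatistic hK hr hf hM
  have hm2 : AEMeasurable (fun ω => ENNReal.ofReal (Real.exp (t * linearStatistic X f ω))) P :=
    (hYm.const_mul t).exp.ennreal_ofReal
  rw [lintegral_congr_ae hlin, lintegral_const_mul'' _ hm2] at hmain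
  have hI : Integrable (fun ω => Real.exp (t * linearStatistic X f ω)) P := by
    refine Integrable.of_bound (hYm.const_mul t).exp.aestronglyMeasurable (Real.exp (t * (r * M))) ?_
    filter_upwards [hX.abs_linearStatistic_le hK hr hM] with ω h
    rw [Real.norm_eq_abs, Real.abs_exp]
    exact Real.exp_le_exp.2 (mul_le_mul_of_nonneg_left ((le_abs_self _).trans h) ht)
  rw [← ofReal_integral_eq_lintegral_ofReal hI (Filter.Eventually.of_forall fun ω => (Real.exp_pos _).le),
    ← ENNReal.ofReal_mul (by positivity), ENNReal.ofReal_le_ofReal_iff (by positivity)] at hmain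
  have hsplit : Real.exp a = Real.exp (t * M * r) * Real.exp (t * E + r * (t * (2 * M)) ^ 2) := by
    rw [← Real.exp_add, ha]
    ring_nf
  rw [hsplit] at hmain
  exact le_of_mul_le_mul_left hmain (Real.exp_pos _)

theorem IsDeterminantal.measure_upper_tail_le (hX : IsDeterminantal P X lam K)
    (hK : IsProjectionKernel lam K) (hr : HasFiniteRank hK) (hf : Measurable f)
    (hM : ∀ x, |f x| ≤ M) (hM0 : 0 < M) (hr0 : 0 < kernelRank hK) {ε : ℝ} (hε : 0 ≤ ε)
    (hεM : ε ≤ 4 * kernelRank hK * M) :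
    P.real {ω | ε ≤ linearStatistic X f ω - ∫ ω', linearStatistic X f ω' ∂P}
      ≤ Real.exp (-(ε ^ 2 / (16 * kernelRank hK * M ^ 2))) := by
  set r := kernelRank hK with hrdef
  set E := ∫ ω, linearStatistic X f ω ∂P with hE
  have hr' : (0 : ℝ) < r := by exact_mod_cast hr0
  -- The minimiser of the Chernoff exponent `-tε + 4rM²t²`; the condition `2tM ≤ 1` becomes `ε ≤
  -- 4rM`.
  set t := ε / (8 * r * M ^ 2) with htdef
  have ht : 0 ≤ t := by positivity
  have htM : t * (2 * M) ≤ 1 := by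
    rw [htdef, div_mul_eq_mul_div, div_le_one (by positivity)]
    nlinarith
  have hYm := hX.aemeasurable_linearStatistic hK hr hf hM
  have hI : Integrable (fun ω => Real.exp (t * linearStatistic X f ω)) P := by
    refine Integrable.of_bound (hYm.const_mul t).exp.aestronglyMeasurable (Real.exp (t * (r * M))) ?_
    filter_upwards [hX.abs_linearStatistic_le hK hr hM] with ω h
    rw [Real.norm_eq_abs, Real.abs_exp]
    exact Real.exp_le_exp.2 (mul_le_mul_of_nonneg_left ((le_abs_self _).trans h) ht)
  have h1 := measure_ge_le_exp_mul_mgf (ε + E) ht hI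
  have hset : {ω | ε ≤ linearStatistic X f ω - E} = {ω | ε + E ≤ linearStatistic X f ω} := by
    ext ω
    simp only [Set.mem_ofPred_eq, le_sub_iff_add_le]
  rw [hset]
  refine h1.trans ((mul_le_mul_of_nonneg_left
    (hX.mgf_linearStatistic_le hK hr hf hM ht htM) (Real.exp_pos _).le).trans_eq ?_)
  rw [← Real.exp_add]
  congr 1
  rw [← hE, ← hrdef, htdef]
  field_simp
  ring

theorem IsDeterminantal.measure_tail_le (hX : IsDeterminantal P X lam K)
    (hK : IsProjectionKernel lam K) (hr : HasFiniteRank hK) (hf : Measurable f)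
    (hM : ∀ x, |f x| ≤ M) (hM0 : 0 < M) (hr0 : 0 < kernelRank hK) {ε : ℝ} (hε : 0 ≤ ε)
    (hεM : ε ≤ 4 * kernelRank hK * M) :
    P.real {ω | ε ≤ |linearStatistic X f ω - ∫ ω', linearStatistic X f ω' ∂P|}
      ≤ 2 * Real.exp (-(ε ^ 2 / (16 * kernelRank hK * M ^ 2))) := by
  have h1 := hX.measure_upper_tail_le hK hr hf hM hM0 hr0 hε hεM
  have h2 := hX.measure_upper_tail_le hK hr (f := fun x => -f x) hf.neg
    (fun x => by rw [abs_neg]; exact hM x) hM0 hr0 hε hεM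
  simp only [linearStatistic_neg, integral_neg] at h2
  have hsub : {ω | ε ≤ |linearStatistic X f ω - ∫ ω', linearStatistic X f ω' ∂P|}
      ⊆ {ω | ε ≤ linearStatistic X f ω - ∫ ω', linearStatistic X f ω' ∂P}
        ∪ {ω | ε ≤ -linearStatistic X f ω - -∫ ω', linearStatistic X f ω' ∂P} := by
    intro ω hω
    rw [Set.mem_ofPred_eq] at hω
    rcases le_abs.1 hω with h | h
    · exact Or.inl h
    · refine Or.inr ?_
      rw [Set.mem_ofPred_eq]
      linarith
  linarith [(measureReal_mono hsub).trans (measureReal_union_le (μ := P) _ _)]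

/-- Almost surely both the statistic and its mean lie in `[-rM, rM]`. -/
theorem IsDeterminantal.measure_tail_eq_zero (hX : IsDeterminantal P X lam K)
    (hK : IsProjectionKernel lam K) (hr : HasFiniteRank hK) (hM : ∀ x, |f x| ≤ M) {ε : ℝ}
    (hε : 2 * kernelRank hK * M < ε) :
    P.real {ω | ε ≤ |linearStatistic X f ω - ∫ ω', linearStatistic X f ω' ∂P|} = 0 := by
  have hae := hX.abs_linearStatistic_le hK hr hM
  have hE : |∫ ω', linearStatistic X f ω' ∂P| ≤ kernelRank hK * M := by
    have := norm_integral_le_of_norm_le_const (f := linearStatistic X f) hae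
    simpa using this
  rw [measureReal_eq_zero_iff]
  refine measure_mono_null ?_ (ae_iff.1 hae)
  intro ω hω h
  have := abs_sub (linearStatistic X f ω) (∫ ω', linearStatistic X f ω' ∂P)
  rw [Set.mem_ofPred_eq] at hω
  linarith

end Bounded

end LinearStatistics

end DPP

/-! ### The concentration inequality. -/

theorem mainTheorem6 :
    ∃ A : ℝ, 0 < A ∧
      ∀ (Λ : Type*) [TopologicalSpace Λ] [PolishSpace Λ] [LocallyCompactSpace Λ]
        [MeasurableSpace Λ] [BorelSpace Λ] (lam : Measure Λ) [IsLocallyFiniteMeasure lam]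
        (K : Λ → Λ → ℂ) (hK : DPP.IsProjectionKernel lam K) (_ : DPP.HasFiniteRank hK)
        (Ω : Type*) [MeasurableSpace Ω] (P : Measure Ω) [IsProbabilityMeasure P]
        (X : Ω → Set Λ) (_ : DPP.IsDeterminantal P X lam K)
        (f : Λ → ℝ) (_ : Measurable f) (_ : ∃ C : ℝ, ∀ x, |f x| ≤ C),
        MemLp (DPP.linearStatistic X f) 2 P ∧
        variance (DPP.linearStatistic X f) P ≤ 2 * DPP.kernelRank hK * DPP.supNorm f ^ 2 ∧
        ∀ ε : ℝ, 0 < ε →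
          (ε < 4 * A * DPP.kernelRank hK * DPP.supNorm f / 3 →
            P.real {ω | ε ≤ |DPP.linearStatistic X f ω - ∫ ω', DPP.linearStatistic X f ω' ∂P|}
              ≤ 2 * Real.exp (-(ε ^ 2 / (8 * A * DPP.kernelRank hK * DPP.supNorm f ^ 2)))) ∧
          (4 * A * DPP.kernelRank hK * DPP.supNorm f / 3 ≤ ε →
            P.real {ω | ε ≤ |DPP.linearStatistic X f ω - ∫ ω', DPP.linearStatistic X f ω' ∂P|}
              ≤ 2 * Real.exp (-(ε / (6 * DPP.supNorm f)))) := by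
  -- `8A = 16` matches the Gaussian exponent, and the threshold `8r‖f‖/3` lies between `2r‖f‖`,
  -- beyond which the tail vanishes, and `4r‖f‖`, up to which the Gaussian bound holds.
  refine ⟨2, by norm_num, ?_⟩
  intro Λ _ _ _ _ _ lam _ K hK hr Ω _ P _ X hX f hf ⟨C, hC⟩
  have hM : ∀ x, |f x| ≤ DPP.supNorm f := le_ciSup ⟨C, by rintro _ ⟨x, rfl⟩; exact hC x⟩
  have hM0 : 0 ≤ DPP.supNorm f := Real.iSup_nonneg fun x => abs_nonneg _
  have hr0 : (0 : ℝ) ≤ DPP.kernelRank hK := Nat.cast_nonneg _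
  have hprod := mul_nonneg hr0 hM0
  refine ⟨hX.memLp_linearStatistic hK hr hf hM,
    hX.variance_linearStatistic_le hK hr hf hM hM0, fun ε hε => ⟨fun h => ?_, fun h => ?_⟩⟩
  · have hpos : 0 < (DPP.kernelRank hK : ℝ) * DPP.supNorm f := by linarith
    have hMpos : 0 < DPP.supNorm f := pos_of_mul_pos_right hpos hr0
    have hrpos : (0 : ℝ) < DPP.kernelRank hK := pos_of_mul_pos_left hpos hM0
    have h1 := hX.measure_tail_le hK hr hf hM hMpos (by exact_mod_cast hrpos) hε.le (by linarith)
    norm_num at h1 ⊢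
    exact h1
  · rw [hX.measure_tail_eq_zero hK hr hM]
    · positivity
    -- The strict inequality `2r‖f‖ < ε` comes from `ε > 0` if `r‖f‖ = 0`, and otherwise from `2 <
    -- 8/3`.
    · rcases hprod.eq_or_lt with h0 | h0 <;> linarith
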